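/- For $L>0$ let $h_L=-\frac{d^2}{dx^2}+v$ be the Schrödinger operator on $L^2((-L/2,L/2))$ with Dirichlet boundary conditions at $x=\pm L/2$, where $$v(x):=\frac{\mathbf 1_{x\ge 1}}{x^2},\qquad x\in\mathbb R,$$ that is, $v(x)=1/x^2$ for $x\ge 1$ and $v(x)=0$ for $x<1$. Let $\varepsilon_0(L)<\varepsilon_1(L)\le\cdots$ be the eigenvalues of $h_L$, in increasing order and counted with multiplicities, and let $\Gamma_v(L):=\varepsilon_1(L)-\varepsilon_0(L)$ be its spectral gap. Then there exist constants $0<\alpha<\beta$ such that $$\frac{\alpha}{L^2}\le\Gamma_v(L)\le\frac{\beta}{L^2}$$ for all sufficiently large $L$. -/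

import Mathlib

open MeasureTheory Set Filter

noncomputable section

namespace SpectralGap

/-- The open interval `(-L/2, L/2)`. -/
abbrev box (L : ℝ) : Set ℝ := Ioo (-(L / 2)) (L / 2)

/-- The complex Hilbert space `L²((-L/2, L/2))`. -/
abbrev L2Box (L : ℝ) : Type := Lp ℂ 2 (volume.restrict (box L))

/-- `u` belongs to `H²((-L/2, L/2))`, with first derivative `p` and second derivative `q`, and
satisfies Dirichlet boundary conditions at `±L/2`: `u` is differentiable on `[-L/2, L/2]` with
derivative `p`, and `p` is a primitive (hence absolutely continuous) of `q ∈ L²((-L/2, L/2))`. -/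
structure IsH2Dirichlet (L : ℝ) (u p q : ℝ → ℂ) : Prop where
  hasDeriv : ∀ x ∈ Icc (-(L / 2)) (L / 2), HasDerivWithinAt u (p x) (Icc (-(L / 2)) (L / 2)) x
  memLp : MemLp q 2 (volume.restrict (box L))
  primitive : ∀ x ∈ Icc (-(L / 2)) (L / 2), p x = p (-(L / 2)) + ∫ t in (-(L / 2))..x, q t
  left : u (-(L / 2)) = 0
  right : u (L / 2) = 0

theorem IsH2Dirichlet.intervalIntegrable {L : ℝ} {u p q : ℝ → ℂ} (h : IsH2Dirichlet L u p q)
    {x : ℝ} (hx : x ∈ Icc (-(L / 2)) (L / 2)) :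
    IntervalIntegrable q volume (-(L / 2)) x := by
  have h1 : Integrable q (volume.restrict (box L)) := h.memLp.integrable (by norm_num)
  rw [intervalIntegrable_iff_integrableOn_Ioo_of_le hx.1]
  exact IntegrableOn.mono_set h1 (Ioo_subset_Ioo_right hx.2)

theorem IsH2Dirichlet.zero (L : ℝ) : IsH2Dirichlet L 0 0 0 where
  hasDeriv x _ := hasDerivWithinAt_const x _ (0 : ℂ)
  memLp := MemLp.zero
  primitive x _ := by simp
  left := rfl
  right := rfl

theorem IsH2Dirichlet.add {L : ℝ} {u p q u' p' q' : ℝ → ℂ} (h : IsH2Dirichlet L u p q)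
    (h' : IsH2Dirichlet L u' p' q') : IsH2Dirichlet L (u + u') (p + p') (q + q') where
  hasDeriv x hx := (h.hasDeriv x hx).add (h'.hasDeriv x hx)
  memLp := h.memLp.add h'.memLp
  primitive x hx := by
    simp only [Pi.add_apply]
    rw [intervalIntegral.integral_add (h.intervalIntegrable hx) (h'.intervalIntegrable hx),
      h.primitive x hx, h'.primitive x hx]
    ring
  left := by simp [h.left, h'.left]
  right := by simp [h.right, h'.right]

theorem IsH2Dirichlet.smul {L : ℝ} {u p q : ℝ → ℂ} (c : ℂ) (h : IsH2Dirichlet L u p q) :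
    IsH2Dirichlet L (c • u) (c • p) (c • q) where
  hasDeriv x hx := (h.hasDeriv x hx).const_smul c
  memLp := h.memLp.const_smul c
  primitive x hx := by
    simp only [Pi.smul_apply]
    rw [intervalIntegral.integral_smul, h.primitive x hx, smul_add]
  left := by simp [h.left]
  right := by simp [h.right]

/-- The graph of the Schrödinger operator `-d²/dx² + v` on `L²((-L/2, L/2))` with Dirichlet boundary
conditions at `±L/2`: all pairs `(f, g)` in which `f` is the class of a function `u` in `H²` that
vanishes at `±L/2` and `g` is the class of `-u'' + v u`. -/
def dirichletGraph (v : ℝ → ℝ) (L : ℝ) : Submodule ℂ (L2Box L × L2Box L) where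
  carrier := {z | ∃ u p q : ℝ → ℂ, IsH2Dirichlet L u p q ∧
    z.1 =ᵐ[volume.restrict (box L)] u ∧
    z.2 =ᵐ[volume.restrict (box L)] fun x => -q x + (v x : ℂ) * u x}
  zero_mem' := by
    refine ⟨0, 0, 0, IsH2Dirichlet.zero L, Lp.coeFn_zero _ _ _, ?_⟩
    filter_upwards [Lp.coeFn_zero ℂ 2 (volume.restrict (box L))] with x hx
    simpa using hx
  add_mem' := by
    rintro ⟨f, g⟩ ⟨f', g'⟩ ⟨u, p, q, h, hf, hg⟩ ⟨u', p', q', h', hf', hg'⟩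
    refine ⟨u + u', p + p', q + q', h.add h', ?_, ?_⟩
    · filter_upwards [Lp.coeFn_add f f', hf, hf'] with x h1 h2 h3
      simp only [Prod.mk_add_mk] at *
      rw [h1, Pi.add_apply, Pi.add_apply, h2, h3]
    · filter_upwards [Lp.coeFn_add g g', hg, hg'] with x h1 h2 h3
      simp only [Prod.mk_add_mk] at *
      rw [h1, Pi.add_apply, Pi.add_apply, Pi.add_apply, h2, h3]
      ring
  smul_mem' := by
    rintro c ⟨f, g⟩ ⟨u, p, q, h, hf, hg⟩
    refine ⟨c • u, c • p, c • q, h.smul c, ?_, ?_⟩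
    · filter_upwards [Lp.coeFn_smul c f, hf] with x h1 h2
      simp only [Prod.smul_mk] at *
      rw [h1, Pi.smul_apply, Pi.smul_apply, h2]
    · filter_upwards [Lp.coeFn_smul c g, hg] with x h1 h2
      simp only [Prod.smul_mk] at *
      rw [h1, Pi.smul_apply, Pi.smul_apply, Pi.smul_apply, h2]
      simp only [smul_eq_mul]
      ring

/-- `-u'' + v u` is determined by `u`, so the pairs above do form the graph of an operator. -/
theorem dirichletGraph_functional (v : ℝ → ℝ) (L : ℝ) :
    ∀ z ∈ dirichletGraph v L, z.1 = 0 → z.2 = 0 := by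
  rintro ⟨f, g⟩ ⟨u, p, q, h, hf, hg⟩ hz
  simp only at hf hg hz ⊢
  subst hz
  have hu0 : EqOn u 0 (box L) := by
    refine Measure.eqOn_open_of_ae_eq (μ := volume) ?_ isOpen_Ioo ?_ continuousOn_const
    · filter_upwards [hf, Lp.coeFn_zero ℂ 2 (volume.restrict (box L))] with x h1 h2
      rw [← h1, h2]
    · exact fun x hx =>
        ((h.hasDeriv x (Ioo_subset_Icc_self hx)).mono Ioo_subset_Icc_self).continuousWithinAt
  have hp0 : ∀ x ∈ box L, p x = 0 := by
    intro x hx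
    have h1 : HasDerivAt u (p x) x :=
      (h.hasDeriv x (Ioo_subset_Icc_self hx)).hasDerivAt (Icc_mem_nhds hx.1 hx.2)
    have h2 : HasDerivAt u 0 x := by
      refine (hasDerivAt_const x (0 : ℂ)).congr_of_eventuallyEq ?_
      filter_upwards [isOpen_Ioo.mem_nhds hx] with y hy using hu0 hy
    exact h1.unique h2
  have hq0 : ∀ᵐ x ∂(volume.restrict (box L)), q x = 0 := by
    rcases le_or_gt L 0 with hL | hL
    · have : box L = ∅ := Ioo_eq_empty (by linarith)
      simp [this]
    have hR : L / 2 ∈ Icc (-(L / 2)) (L / 2) := ⟨by linarith, le_rfl⟩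
    have hae := (h.intervalIntegrable hR).ae_hasDerivAt_integral
    rw [ae_restrict_iff' measurableSet_Ioo]
    filter_upwards [hae] with x hx hxI
    have h1 := hx (by rw [uIcc_of_le hR.1]; exact Ioo_subset_Icc_self hxI) (-(L / 2)) left_mem_uIcc
    have h2 : HasDerivAt (fun y => ∫ t in (-(L / 2))..y, q t) 0 x := by
      refine (hasDerivAt_const x (-p (-(L / 2)))).congr_of_eventuallyEq ?_
      filter_upwards [isOpen_Ioo.mem_nhds hxI] with y hy
      have := h.primitive y (Ioo_subset_Icc_self hy)
      rw [hp0 y hy] at this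
      linear_combination -this
    exact h1.unique h2
  apply Lp.ext
  filter_upwards [hg, hq0, ae_restrict_mem measurableSet_Ioo,
    Lp.coeFn_zero ℂ 2 (volume.restrict (box L))] with x h1 h2 h3 h4
  rw [h1, h2, h4, hu0 h3]
  simp

/-- The Schrödinger operator `-d²/dx² + v` on `L²((-L/2, L/2))` with Dirichlet boundary conditions,
as an unbounded operator with domain `H² ∩ H¹₀` (for bounded `v`). -/
def dirichletSchrodinger (v : ℝ → ℝ) (L : ℝ) : L2Box L →ₗ.[ℂ] L2Box L :=
  (dirichletGraph v L).toLinearPMap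

theorem mem_graph_dirichletSchrodinger {v : ℝ → ℝ} {L : ℝ} {z : L2Box L × L2Box L} :
    z ∈ (dirichletSchrodinger v L).graph ↔ ∃ u p q : ℝ → ℂ, IsH2Dirichlet L u p q ∧
      z.1 =ᵐ[volume.restrict (box L)] u ∧
      z.2 =ᵐ[volume.restrict (box L)] fun x => -q x + (v x : ℂ) * u x := by
  rw [dirichletSchrodinger, Submodule.toLinearPMap_graph_eq _ (dirichletGraph_functional v L)]
  rfl

section Eigenvalues

variable {E : Type*} [AddCommGroup E] [Module ℂ E]

/-- The eigenspace of an unbounded operator `T` at `μ`: all `f` in the domain of `T` with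
`T f = μ f`. -/
def eigenspace (T : E →ₗ.[ℂ] E) (μ : ℂ) : Submodule ℂ E :=
  T.graph.comap (LinearMap.prod LinearMap.id (μ • LinearMap.id))

theorem mem_eigenspace {T : E →ₗ.[ℂ] E} {μ : ℂ} {f : E} :
    f ∈ eigenspace T μ ↔ ∃ h : f ∈ T.domain, T ⟨f, h⟩ = μ • f := by
  simp [eigenspace, LinearPMap.mem_graph_iff]

/-- The span of all eigenvectors of `T` with real eigenvalue at most `t`. Its dimension is the number
of eigenvalues of `T` in `(-∞, t]`, counted with multiplicities. -/
def eigenspan (T : E →ₗ.[ℂ] E) (t : ℝ) : Submodule ℂ E :=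
  ⨆ μ ∈ Iic t, eigenspace T (μ : ℂ)

/-- The `n`-th eigenvalue, `n = 0, 1, 2, …`, in increasing order and counted with multiplicities, of
an operator whose spectrum consists of real eigenvalues of finite multiplicity that tend to `∞`: the
least real `t` such that there are at least `n + 1` eigenvalues in `(-∞, t]`. -/
def eigenvalue (T : E →ₗ.[ℂ] E) (n : ℕ) : ℝ :=
  sInf {t : ℝ | ((n + 1 : ℕ) : Cardinal) ≤ Module.rank ℂ (eigenspan T t)}

end Eigenvalues

/-- The spectral gap of `-d²/dx² + v` on `(-L/2, L/2)` with Dirichlet boundary conditions: the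
difference of its two lowest eigenvalues. -/
def gap (v : ℝ → ℝ) (L : ℝ) : ℝ :=
  eigenvalue (dirichletSchrodinger v L) 1 - eigenvalue (dirichletSchrodinger v L) 0

/-- The potential `v(x) = 1_{x ≥ 1} / x²`. -/
def inverseSquare : ℝ → ℝ :=
  indicator (Ici 1) fun x => 1 / x ^ 2

end SpectralGap

end

/-!
The proof rests on a scaled Prüfer angle. Write `R = L / 2` and let `u` solve `-u'' + v u = k² u` with
`u (-R) = 0`. In `u = r sin θ`, `u' = k r cos θ` the angle satisfies `θ' = k - v sin² θ / k`. To the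
left of `1` the potential vanishes and `θ = k (x + R)`, so only the equation on `[1, R]` with
`θ 1 = k (1 + R)` has to be studied (`IsPrueferAngle`). The number `k²` is an eigenvalue exactly when
`θ R` is a multiple of `π`, and then it is simple (`IsPrueferAngle.eigenspace_ne_bot_iff`,
`IsPrueferAngle.rank_eigenspace_le_one`); there are no eigenvalues `μ ≤ 0`, because `|u|²` would be
convex and zero at both endpoints (`IsSolution.eqOn_zero_of_nonpos`). The endpoint value `θ R` is
positive, continuous and strictly increasing in `k`, so `ε₀ = k₀²` and `ε₁ = k₁²`, where `θ R = π`
for `k₀` and `θ R = 2π` for `k₁`.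

The angle crosses multiples of `π` only upwards, so `θ R ≥ n π` as soon as `θ 1 = k (1 + R) ≥ n π`.
This gives `k₀ ≤ π / (1 + R)` and `k₁ ≤ 2 π / (1 + R)` (`exists_isPrueferAngle_eq`): the free left half
of the box already supports the ground state energy `(2π / L)²`. For the second eigenvalue, the
potential is at least `1 / R²` on `[1, R]` and slows the angle down on its way from `θ 1 ≈ k R` to
`2π`. This delay is bounded below independently of `L`, and it forces `k₁ R ≥ π + 1/25`
(`IsPrueferAngle.wave_number_ge`), while `k₀ R ≤ π`. Hence the gap is of order exactly `L⁻²`.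
-/

noncomputable section

namespace SpectralGap

/-! ### Elementary inequalities -/

theorem abs_sin_sq_sub_sin_sq_le (a b : ℝ) : |Real.sin a ^ 2 - Real.sin b ^ 2| ≤ |a - b| := by
  have h : Real.sin a ^ 2 - Real.sin b ^ 2 = Real.sin (a + b) * Real.sin (a - b) := by
    rw [Real.sin_add, Real.sin_sub]
    linear_combination Real.sin b ^ 2 * Real.sin_sq_add_cos_sq a -
      Real.sin a ^ 2 * Real.sin_sq_add_cos_sq b
  rw [h, abs_mul]
  calc |Real.sin (a + b)| * |Real.sin (a - b)| ≤ 1 * |a - b| := by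
        exact mul_le_mul (Real.abs_sin_le_one _) Real.abs_sin_le_abs (abs_nonneg _) zero_le_one
    _ = |a - b| := one_mul _

theorem sin_sq_le_abs (a : ℝ) : Real.sin a ^ 2 ≤ |a| := by
  simpa using (le_abs_self _).trans (abs_sin_sq_sub_sin_sq_le a 0)

/-- A function whose right derivative is at least `-K D` wherever it is nonnegative stays positive
if it starts positive: it lies above the barrier `D a * exp (-2 K (x - a))`. -/
theorem pos_of_deriv_right_ge {D D' : ℝ → ℝ} {a b K : ℝ} (hK : 0 < K)
    (hD : ContinuousOn D (Icc a b)) (hD' : ∀ x ∈ Ico a b, HasDerivWithinAt D (D' x) (Ici x) x)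
    (ha : 0 < D a) (bound : ∀ x ∈ Ico a b, 0 ≤ D x → -(K * D x) ≤ D' x) :
    ∀ x ∈ Icc a b, 0 < D x := by
  intro x hx
  have hB (y : ℝ) : HasDerivAt (fun y => D a * Real.exp (-(2 * K) * (y - a)))
      (D a * (Real.exp (-(2 * K) * (y - a)) * -(2 * K))) y := by
    have h := (((hasDerivAt_id y).sub_const a).const_mul (-(2 * K))).exp.const_mul (D a)
    simpa using h
  have key := image_le_of_deriv_right_lt_deriv_boundary'
    (f := fun y => D a * Real.exp (-(2 * K) * (y - a))) (B := D) (B' := D')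
    (fun y _ => (hB y).continuousAt.continuousWithinAt)
    (fun y _ => (hB y).hasDerivWithinAt) (by simp) hD hD' (by
      intro y hy heq
      have hpos : 0 < D a * Real.exp (-(2 * K) * (y - a)) := by positivity
      have := bound y hy (heq ▸ hpos.le)
      nlinarith) hx
  exact lt_of_lt_of_le (by positivity) key

/-! ### The Prüfer angle -/

/-- `θ` is a scaled Prüfer angle on `[1, R]` for the wave number `k` of the Dirichlet problem on
`(-R, R)`. It is the angle in `u = r sin θ`, `u' = k r cos θ` for the solution of
`-u'' + v u = k² u` with `u (-R) = 0`. To the left of `1`, where `v = 0`, this angle is `k (x + R)`,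
which explains the initial value. Continuity is required on all of `ℝ` for convenience only. -/
structure IsPrueferAngle (R k : ℝ) (θ : ℝ → ℝ) : Prop where
  continuous : Continuous θ
  init : θ 1 = k * (1 + R)
  hasDerivAt : ∀ x ∈ Icc 1 R, HasDerivAt θ (k - Real.sin (θ x) ^ 2 / (k * x ^ 2)) x

/-- The right-hand side of the differential equation of the Prüfer angle, with `1 / t²` replaced by
`1 / max 1 t ²` so that it is regular for all times. -/
def prueferField (k t x : ℝ) : ℝ := k - Real.sin x ^ 2 / (k * (max 1 t) ^ 2)

theorem le_mul_max_sq {k : ℝ} (hk : 0 < k) (t : ℝ) : k ≤ k * (max 1 t) ^ 2 :=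
  le_mul_of_one_le_right hk.le (one_le_pow₀ (le_max_left _ _))

theorem lipschitzWith_prueferField {k : ℝ} (hk : 0 < k) (t : ℝ) :
    LipschitzWith (Real.toNNReal k⁻¹) (prueferField k t) := by
  refine LipschitzWith.of_dist_le_mul fun x y => ?_
  rw [Real.coe_toNNReal _ (by positivity), Real.dist_eq, Real.dist_eq]
  have hden : 0 < k * (max 1 t) ^ 2 := hk.trans_le (le_mul_max_sq hk t)
  have : prueferField k t x - prueferField k t y =
      -((Real.sin x ^ 2 - Real.sin y ^ 2) / (k * (max 1 t) ^ 2)) := by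
    simp only [prueferField]; ring
  rw [this, abs_neg, abs_div, abs_of_pos hden, div_eq_mul_inv, mul_comm]
  exact mul_le_mul (inv_anti₀ hk (le_mul_max_sq hk t)) (abs_sin_sq_sub_sin_sq_le x y)
    (abs_nonneg _) (by positivity)

theorem exists_isPrueferAngle {R k : ℝ} (hR : 1 < R) (hk : 0 < k) :
    ∃ θ, IsPrueferAngle R k θ := by
  -- The vector field is extended to `[0, R + 1]`, so that `[1, R]` is in the interior.
  set f := prueferField k with hf
  have hden (t : ℝ) : 0 < k * (max 1 t) ^ 2 := hk.trans_le (le_mul_max_sq hk t)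
  have hnorm (t x : ℝ) : ‖f t x‖ ≤ k + k⁻¹ := by
    have h1 : 0 ≤ Real.sin x ^ 2 / (k * (max 1 t) ^ 2) := div_nonneg (sq_nonneg _) (hden t).le
    have h2 : Real.sin x ^ 2 / (k * (max 1 t) ^ 2) ≤ k⁻¹ := by
      rw [div_eq_mul_inv]
      calc _ ≤ 1 * k⁻¹ := by
            gcongr
            · exact Real.sin_sq_le_one x
            · exact le_mul_max_sq hk t
        _ = k⁻¹ := one_mul _
    have h3 : 0 < k⁻¹ := by positivity
    rw [Real.norm_eq_abs, abs_le]
    constructor <;> simp only [hf, prueferField] <;> linarith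
  have h1mem : (1 : ℝ) ∈ Icc (0 : ℝ) (R + 1) := ⟨zero_le_one, by linarith⟩
  have hPL : IsPicardLindelof f (⟨1, h1mem⟩ : Icc (0 : ℝ) (R + 1)) (k * (1 + R))
      (Real.toNNReal ((k + k⁻¹) * (R + 1))) 0 (Real.toNNReal (k + k⁻¹)) (Real.toNNReal k⁻¹) := by
    refine ⟨fun t _ => (lipschitzWith_prueferField hk t).lipschitzOnWith, fun x _ => ?_, fun t _ x _ => ?_, ?_⟩
    · refine Continuous.continuousOn ?_
      exact continuous_const.sub (continuous_const.div
        (by fun_prop) fun t => (hden t).ne')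
    · rw [Real.coe_toNNReal _ (by positivity)]
      exact hnorm t x
    · have : 0 ≤ (k + k⁻¹) * (R + 1) := by positivity
      rw [Real.coe_toNNReal _ (by positivity), Real.coe_toNNReal _ this]
      simp only [NNReal.coe_zero, sub_zero]
      gcongr
      rw [max_le_iff]
      constructor <;> linarith
  obtain ⟨α, hα0, hα⟩ := hPL.exists_eq_forall_mem_Icc_hasDerivWithinAt₀
  have hc : ContinuousOn α (Icc 0 (R + 1)) := fun t ht => (hα t ht).continuousWithinAt
  have h0R : (0 : ℝ) ≤ R + 1 := by linarith
  have heq (t : ℝ) (ht : t ∈ Icc 0 (R + 1)) :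
      IccExtend h0R ((Icc 0 (R + 1)).domRestrict α) t = α t := by
    rw [IccExtend_of_mem _ _ ht]; rfl
  refine ⟨IccExtend h0R ((Icc 0 (R + 1)).domRestrict α), ?_, ?_, fun x hx => ?_⟩
  · exact (continuousOn_iff_continuous_domRestrict.mp hc).Icc_extend'
  · rw [heq 1 h1mem]; exact hα0
  · have hx0 : x ∈ Ioo 0 (R + 1) := ⟨by linarith [hx.1], by linarith [hx.2]⟩
    have h := (hα x (Ioo_subset_Icc_self hx0)).hasDerivAt (Icc_mem_nhds hx0.1 hx0.2)
    rw [heq x (Ioo_subset_Icc_self hx0)]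
    have hfx : f x (α x) = k - Real.sin (α x) ^ 2 / (k * x ^ 2) := by
      simp only [hf, prueferField, max_eq_right hx.1]
    rw [← hfx]
    refine h.congr_of_eventuallyEq ?_
    filter_upwards [Ioo_mem_nhds hx0.1 hx0.2] with t ht using heq t (Ioo_subset_Icc_self ht)

namespace IsPrueferAngle

variable {R k k' : ℝ} {θ θ' : ℝ → ℝ}

theorem le_two_mul (hR : 1 < R) (hk : 0 < k) (h : IsPrueferAngle R k θ) :
    θ R ≤ 2 * (k * R) := by
  have := image_le_of_deriv_right_le_deriv_boundary (f := θ) (a := 1) (b := R)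
    (B := fun x => k * (x + R)) (B' := fun _ => k) h.continuous.continuousOn
    (fun x hx => (h.hasDerivAt x (Ico_subset_Icc_self hx)).hasDerivWithinAt)
    (by rw [h.init]) (by fun_prop)
    (fun x _ => by
      simpa using (((hasDerivAt_id x).add_const R).const_mul k).hasDerivWithinAt)
    (fun x _ => by
      have : 0 ≤ Real.sin (θ x) ^ 2 / (k * x ^ 2) := by positivity
      linarith) (right_mem_Icc.mpr hR.le)
  linarith

theorem pos (hR : 1 < R) (hk : 0 < k) (h : IsPrueferAngle R k θ) : 0 < θ R := by
  refine pos_of_deriv_right_ge (D := θ) (a := 1) (b := R) (K := k⁻¹) (by positivity)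
    h.continuous.continuousOn
    (fun x hx => (h.hasDerivAt x (Ico_subset_Icc_self hx)).hasDerivWithinAt)
    (by rw [h.init]; positivity) (fun x hx h0 => ?_) R (right_mem_Icc.mpr hR.le)
  have h1 : Real.sin (θ x) ^ 2 / (k * x ^ 2) ≤ k⁻¹ * θ x := by
    rw [div_eq_mul_inv, mul_comm]
    have hx1 : 1 ≤ x ^ 2 := one_le_pow₀ hx.1
    gcongr
    · exact le_mul_of_one_le_right hk.le hx1
    · simpa [abs_of_nonneg h0] using sin_sq_le_abs (θ x)
  linarith

/-- The angle crosses the multiples of `π` only upwards. -/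
theorem natCast_mul_pi_le (hR : 1 < R) (hk : 0 < k) (h : IsPrueferAngle R k θ) {n : ℕ}
    (hn : n * Real.pi ≤ k * (1 + R)) : n * Real.pi ≤ θ R := by
  refine image_le_of_deriv_right_lt_deriv_boundary' (f := fun _ => n * Real.pi) (f' := fun _ => 0)
    (a := 1) (b := R) (B := θ) continuousOn_const (fun x _ => hasDerivWithinAt_const _ _ _)
    (by rw [h.init]; exact hn) h.continuous.continuousOn
    (fun x hx => (h.hasDerivAt x (Ico_subset_Icc_self hx)).hasDerivWithinAt)
    (fun x hx heq => ?_) (right_mem_Icc.mpr hR.le)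
  -- At a multiple of `π` the potential term vanishes and the slope is `k`.
  rw [← heq, Real.sin_nat_mul_pi]
  simpa using hk

/-- The angle at the right endpoint is strictly increasing in the wave number. -/
theorem lt_of_lt (hR : 1 < R) (hk : 0 < k) (hkk : k < k') (h : IsPrueferAngle R k θ)
    (h' : IsPrueferAngle R k' θ') : θ R < θ' R := by
  have hk' : 0 < k' := hk.trans hkk
  have := pos_of_deriv_right_ge (D := fun x => θ' x - θ x) (a := 1) (b := R) (K := k'⁻¹)
    (by positivity) (h'.continuous.sub h.continuous).continuousOn
    (fun x hx => ((h'.hasDerivAt x (Ico_subset_Icc_self hx)).sub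
      (h.hasDerivAt x (Ico_subset_Icc_self hx))).hasDerivWithinAt)
    (by simp only [h.init, h'.init]; nlinarith) (fun x hx h0 => ?_) R (right_mem_Icc.mpr hR.le)
  · linarith
  · have hx1 : 1 ≤ x ^ 2 := one_le_pow₀ hx.1
    have h1 : Real.sin (θ x) ^ 2 / (k' * x ^ 2) ≤ Real.sin (θ x) ^ 2 / (k * x ^ 2) := by
      gcongr
    have h2 : (Real.sin (θ' x) ^ 2 - Real.sin (θ x) ^ 2) / (k' * x ^ 2)
        ≤ k'⁻¹ * (θ' x - θ x) := by
      calc _ ≤ (θ' x - θ x) / (k' * x ^ 2) := by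
            refine div_le_div_of_nonneg_right ?_ (by positivity)
            exact ((le_abs_self _).trans (abs_sin_sq_sub_sin_sq_le _ _)).trans_eq
              (abs_of_nonneg h0)
        _ ≤ (θ' x - θ x) / k' := by
            gcongr
            exact le_mul_of_one_le_right hk'.le hx1
        _ = _ := by rw [div_eq_mul_inv, mul_comm]
    rw [sub_div] at h2
    linarith

/-- If the angle reaches `2π`, then the wave number exceeds `π / R` by a definite factor.

With `a = (k R)⁻²`, the function `θ + a (θ / 2 - sin (2 θ) / 4)` has derivative
`θ' (1 + a sin² θ) ≤ k (1 - a sin² θ) (1 + a sin² θ) ≤ k` on `[1, R]`, because `1 / x² ≥ 1 / R²`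
there. So the potential delays the angle by about `a ∫ sin²` taken from `θ 1` to `2π`. -/
theorem wave_number_ge (hR : 5 ≤ R) (hk : 0 < k) (h : IsPrueferAngle R k θ)
    (h2 : 2 * Real.pi ≤ θ R) : Real.pi + 1 / 25 ≤ k * R := by
  have hR0 : 0 < R := by linarith
  set a : ℝ := 1 / (k * R) ^ 2 with ha
  have ha0 : 0 < a := by positivity
  set g : ℝ → ℝ := fun t => t + a * (t / 2 - Real.sin (2 * t) / 4) with hg
  have hg' (t : ℝ) : HasDerivAt g (1 + a * Real.sin t ^ 2) t := by
    have h1 : HasDerivAt g (1 + a * (1 / 2 - Real.cos (2 * t) * 2 / 4)) t := by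
      have h3 := ((hasDerivAt_id t).const_mul 2).sin
      simp only [id, mul_one] at h3
      exact (hasDerivAt_id t).add
        ((((hasDerivAt_id t).div_const 2).sub (h3.div_const 4)).const_mul a)
    convert h1 using 1
    rw [Real.cos_two_mul, Real.cos_sq']
    ring
  have hmono : Monotone g := by
    refine monotone_of_deriv_nonneg (fun t => (hg' t).differentiableAt) fun t => ?_
    rw [(hg' t).deriv]
    positivity
  have hle := image_le_of_deriv_right_le_deriv_boundary (f := fun x => g (θ x)) (a := 1) (b := R)
    (B := fun x => g (θ 1) + k * (x - 1)) (B' := fun _ => k)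
    (fun x hx => ((hg' _).comp x (h.hasDerivAt x hx)).continuousAt.continuousWithinAt)
    (fun x hx => ((hg' _).comp x (h.hasDerivAt x (Ico_subset_Icc_self hx))).hasDerivWithinAt)
    (by simp) (by fun_prop)
    (fun x _ => by
      simpa using ((((hasDerivAt_id x).sub_const 1).const_mul k).const_add
        (g (θ 1))).hasDerivWithinAt)
    (fun x hx => by
      have hx0 : 0 < x := by linarith [hx.1]
      set s := Real.sin (θ x) ^ 2 with hs
      have hs0 : 0 ≤ s := sq_nonneg _
      have h1 : s / (k * R ^ 2) ≤ s / (k * x ^ 2) := by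
        have := hx.2.le
        gcongr
      have h3 : s / (k * R ^ 2) = k * (a * s) := by rw [ha]; field_simp
      calc (1 + a * s) * (k - s / (k * x ^ 2)) ≤ (1 + a * s) * (k - k * (a * s)) := by
            rw [← h3]; gcongr
        _ ≤ k := by nlinarith [mul_nonneg hk.le (sq_nonneg (a * s))])
    (right_mem_Icc.mpr (by linarith))
  have hle2 : g (2 * Real.pi) ≤ g (θ 1) + k * (R - 1) := (hmono h2).trans hle
  have hsin : Real.sin (2 * (2 * Real.pi)) = 0 := by
    rw [show 2 * (2 * Real.pi) = (4 : ℕ) * Real.pi by push_cast; ring, Real.sin_nat_mul_pi]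
  have hs1 := Real.neg_one_le_sin (2 * (k * (1 + R)))
  simp only [hg, h.init, hsin] at hle2
  set y := k * R with hy
  have hy0 : 0 < y := by positivity
  have hky : k ≤ y / 5 := by rw [hy]; nlinarith
  have hkey : a * (Real.pi - 3 / 5 * y - 1 / 4) ≤ 2 * (y - Real.pi) := by
    have h4 : k * (1 + R) = k + y := by rw [hy]; ring
    rw [h4] at hle2 hs1
    have h5 : a * ((k + y) / 2 - Real.sin (2 * (k + y)) / 4) ≤ a * (3 / 5 * y + 1 / 4) := by
      gcongr; linarith
    have h6 : k * (R - 1) = y - k := by rw [hy]; ring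
    rw [h6] at hle2
    nlinarith
  have hkey2 : Real.pi - 3 / 5 * y - 1 / 4 ≤ 2 * (y - Real.pi) * y ^ 2 := by
    rw [ha, one_div, inv_mul_le_iff₀ (by positivity)] at hkey
    linarith
  have hpi1 := Real.pi_gt_d2
  have hpi2 := Real.pi_lt_d2
  by_contra hlt
  push Not at hlt
  rcases le_or_gt y Real.pi with hle | hgt
  · nlinarith [mul_nonneg (sub_nonneg.mpr hle) (sq_nonneg y)]
  · have hy2 : y ^ 2 ≤ 11 := by nlinarith
    have : 2 * (y - Real.pi) * y ^ 2 ≤ 2 * (1 / 25) * 11 := by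
      gcongr
      linarith
    linarith

/-- Quantitative continuity in the wave number, from Grönwall's inequality. -/
theorem dist_le (hR : 1 < R) (hk : 0 < k) (hk' : 0 < k') (h : IsPrueferAngle R k θ)
    (h' : IsPrueferAngle R k' θ') :
    dist (θ' R) (θ R) ≤
      gronwallBound (|k' - k| * (1 + R)) k⁻¹ (|k' - k| + |k'⁻¹ - k⁻¹|) (R - 1) := by
  have hcoe : ((Real.toNNReal k⁻¹ : NNReal) : ℝ) = k⁻¹ := Real.coe_toNNReal _ (by positivity)
  have := dist_le_of_approx_trajectories_ODE (v := prueferField k) (K := Real.toNNReal k⁻¹) (a := 1) (b := R)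
    (f := θ') (g := θ) (εf := |k' - k| + |k'⁻¹ - k⁻¹|) (εg := 0) (δ := |k' - k| * (1 + R))
    (lipschitzWith_prueferField hk)
    h'.continuous.continuousOn
    (fun x hx => (h'.hasDerivAt x (Ico_subset_Icc_self hx)).hasDerivWithinAt)
    (fun x hx => by
      have hx1 : 1 ≤ x ^ 2 := one_le_pow₀ hx.1
      have hx0 : 0 < x := by linarith [hx.1]
      have heq : k' - Real.sin (θ' x) ^ 2 / (k' * x ^ 2) - prueferField k x (θ' x)
          = (k' - k) - Real.sin (θ' x) ^ 2 / x ^ 2 * (k'⁻¹ - k⁻¹) := by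
        simp only [prueferField, max_eq_right hx.1]
        field_simp
        ring
      rw [Real.dist_eq, heq]
      refine (abs_sub _ _).trans ?_
      refine add_le_add le_rfl ?_
      rw [abs_mul]
      refine mul_le_of_le_one_left (abs_nonneg _) ?_
      rw [abs_of_nonneg (by positivity), div_le_one (by positivity)]
      exact (Real.sin_sq_le_one _).trans hx1)
    h.continuous.continuousOn
    (fun x hx => (h.hasDerivAt x (Ico_subset_Icc_self hx)).hasDerivWithinAt)
    (fun x hx => by simp [prueferField, max_eq_right hx.1])
    (by rw [h.init, h'.init, Real.dist_eq, ← sub_mul, abs_mul, abs_of_pos (by linarith : 0 < 1 + R)])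
    R (right_mem_Icc.mpr hR.le)
  rwa [hcoe, add_zero] at this

end IsPrueferAngle

/-- The Prüfer angle takes the value `n π` at the right endpoint for some wave number at most
`n π / (1 + R)`. -/
theorem exists_isPrueferAngle_eq {R : ℝ} (hR : 1 < R) {n : ℕ} (hn : 0 < n) :
    ∃ k θ, 0 < k ∧ k * (1 + R) ≤ n * Real.pi ∧ IsPrueferAngle R k θ ∧ θ R = n * Real.pi := by
  have hex (k : ℝ) : ∃ θ, 0 < k → IsPrueferAngle R k θ := by
    by_cases hk : 0 < k
    · exact (exists_isPrueferAngle hR hk).imp fun _ h _ => h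
    · exact ⟨0, fun h => absurd h hk⟩
  choose Θ hΘ using hex
  have hcont {k : ℝ} (hk : 0 < k) : ContinuousAt (fun k => Θ k R) k := by
    rw [ContinuousAt, tendsto_iff_dist_tendsto_zero]
    refine squeeze_zero' (.of_forall fun _ => dist_nonneg)
      ((lt_mem_nhds hk).mono fun k' hk' => (hΘ k hk).dist_le hR hk hk' (hΘ k' hk')) ?_
    have hc : ContinuousAt (fun k' : ℝ => gronwallBound (|k' - k| * (1 + R))
        k⁻¹ (|k' - k| + |k'⁻¹ - k⁻¹|) (R - 1)) k := by
      simp only [gronwallBound_of_K_ne_0 (inv_ne_zero hk.ne')]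
      have h1 : ContinuousAt (fun k' : ℝ => k'⁻¹) k := continuousAt_inv₀ hk.ne'
      fun_prop
    simpa [gronwallBound_ε0] using hc.tendsto
  have hpi := Real.pi_pos
  set kb := n * Real.pi / (1 + R) with hkb
  have hkb0 : 0 < kb := by positivity
  have hkbR : kb * (1 + R) = n * Real.pi := by rw [hkb]; field_simp
  have hA : Θ (kb / 2) R ≤ n * Real.pi := by
    refine ((hΘ _ (half_pos hkb0)).le_two_mul hR (half_pos hkb0)).trans ?_
    linarith
  have hB : n * Real.pi ≤ Θ kb R := (hΘ kb hkb0).natCast_mul_pi_le hR hkb0 hkbR.ge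
  obtain ⟨k, hk, hkeq⟩ := intermediate_value_Icc (half_le_self hkb0.le)
    (fun k hk => (hcont ((half_pos hkb0).trans_le hk.1)).continuousWithinAt) ⟨hA, hB⟩
  have hk0 : 0 < k := (half_pos hkb0).trans_le hk.1
  refine ⟨k, Θ k, hk0, ?_, hΘ k hk0, hkeq⟩
  rw [← hkbR]
  have := hk.2
  gcongr

/-! ### The eigenvalue equation as an initial value problem -/

theorem inverseSquare_of_lt {x : ℝ} (hx : x < 1) : inverseSquare x = 0 :=
  indicator_of_notMem (by simpa using hx) _

theorem inverseSquare_of_le {x : ℝ} (hx : 1 ≤ x) : inverseSquare x = 1 / x ^ 2 :=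
  indicator_of_mem (by simpa using hx) _

theorem inverseSquare_nonneg (x : ℝ) : 0 ≤ inverseSquare x :=
  indicator_nonneg (fun _ _ => by positivity) x

theorem inverseSquare_le_one (x : ℝ) : inverseSquare x ≤ 1 := by
  rcases lt_or_ge x 1 with hx | hx
  · rw [inverseSquare_of_lt hx]; exact zero_le_one
  · rw [inverseSquare_of_le hx]
    exact div_le_one_of_le₀ (one_le_pow₀ hx) (by positivity)

theorem measurable_inverseSquare : Measurable inverseSquare :=
  Measurable.indicator (by fun_prop) measurableSet_Ici

/-- The jump of the potential is continuous from the right, which is what makes solutions have a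
second derivative from the right everywhere. -/
theorem continuousWithinAt_inverseSquare (x : ℝ) : ContinuousWithinAt inverseSquare (Ici x) x := by
  rcases lt_or_ge x 1 with hx | hx
  · have : ContinuousAt inverseSquare x :=
      (continuousAt_const (y := (0 : ℝ))).congr
        ((gt_mem_nhds hx).mono fun y hy => (inverseSquare_of_lt hy).symm)
    exact this.continuousWithinAt
  · have h : ContinuousWithinAt (fun y : ℝ => 1 / y ^ 2) (Ici x) x :=
      (continuousAt_const.div (by fun_prop) (by positivity)).continuousWithinAt
    exact h.congr (fun y hy => inverseSquare_of_le (hx.trans hy)) (inverseSquare_of_le hx)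

/-- `u` solves `-u'' + u / x² 1_{x ≥ 1} = μ u` on `[-L/2, L/2]` with `u' = p`, where the second
derivative is taken in the integrated (Carathéodory) sense. No boundary condition is imposed. -/
structure IsSolution (L μ : ℝ) (u p : ℝ → ℂ) : Prop where
  hasDeriv : ∀ x ∈ Icc (-(L / 2)) (L / 2), HasDerivWithinAt u (p x) (Icc (-(L / 2)) (L / 2)) x
  primitive : ∀ x ∈ Icc (-(L / 2)) (L / 2),
    p x = p (-(L / 2)) + ∫ t in (-(L / 2))..x, ((inverseSquare t - μ : ℝ) : ℂ) * u t

theorem norm_inverseSquare_sub_le (x μ : ℝ) : ‖((inverseSquare x - μ : ℝ) : ℂ)‖ ≤ 1 + |μ| := by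
  rw [Complex.norm_real, Real.norm_eq_abs]
  refine (abs_sub _ _).trans ?_
  rw [abs_of_nonneg (inverseSquare_nonneg x)]
  linarith [inverseSquare_le_one x]

theorem memLp_of_continuousOn {L : ℝ} {u : ℝ → ℂ} (hu : ContinuousOn u (Icc (-(L / 2)) (L / 2))) :
    MemLp u 2 (volume.restrict (box L)) := by
  obtain ⟨C, hC⟩ := isCompact_Icc.exists_bound_of_continuousOn hu
  refine MemLp.of_bound
    ((hu.mono Ioo_subset_Icc_self).aestronglyMeasurable measurableSet_Ioo) C ?_
  filter_upwards [ae_restrict_mem measurableSet_Ioo] with x hx using hC x (Ioo_subset_Icc_self hx)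

theorem memLp_potential_mul {L : ℝ} (μ : ℝ) {u : ℝ → ℂ}
    (hu : ContinuousOn u (Icc (-(L / 2)) (L / 2))) :
    MemLp (fun t => ((inverseSquare t - μ : ℝ) : ℂ) * u t) 2 (volume.restrict (box L)) := by
  have hm : Measurable fun t => ((inverseSquare t - μ : ℝ) : ℂ) :=
    Complex.measurable_ofReal.comp (measurable_inverseSquare.sub_const μ)
  refine (memLp_of_continuousOn hu).of_le_mul (c := 1 + |μ|)
    (hm.aestronglyMeasurable.mul
      ((hu.mono Ioo_subset_Icc_self).aestronglyMeasurable measurableSet_Ioo)) ?_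
  refine .of_forall fun x => ?_
  rw [norm_mul]
  gcongr
  exact norm_inverseSquare_sub_le x μ

theorem intervalIntegrable_potential_mul {L μ : ℝ} {u : ℝ → ℂ}
    (hu : ContinuousOn u (Icc (-(L / 2)) (L / 2))) {x : ℝ} (hx : x ∈ Icc (-(L / 2)) (L / 2)) :
    IntervalIntegrable (fun t => ((inverseSquare t - μ : ℝ) : ℂ) * u t) volume (-(L / 2)) x := by
  have h1 := (memLp_potential_mul μ hu).integrable (by norm_num)
  rw [intervalIntegrable_iff_integrableOn_Ioo_of_le hx.1]
  exact IntegrableOn.mono_set h1 (Ioo_subset_Ioo_right hx.2)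

namespace IsSolution

variable {L μ : ℝ} {u p : ℝ → ℂ}

theorem continuousOn (h : IsSolution L μ u p) : ContinuousOn u (Icc (-(L / 2)) (L / 2)) :=
  fun x hx => (h.hasDeriv x hx).continuousWithinAt

theorem continuousOn_deriv (hL : 0 < L) (h : IsSolution L μ u p) :
    ContinuousOn p (Icc (-(L / 2)) (L / 2)) := by
  have hle : -(L / 2) ≤ L / 2 := by linarith
  have hint := intervalIntegrable_potential_mul (μ := μ) h.continuousOn (right_mem_Icc.mpr hle)
  have := intervalIntegral.continuousOn_primitive_interval' hint left_mem_uIcc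
  rw [uIcc_of_le hle] at this
  exact (continuousOn_const.add this).congr h.primitive

theorem hasDerivWithinAt (h : IsSolution L μ u p) {x : ℝ} (hx : x ∈ Ico (-(L / 2)) (L / 2)) :
    HasDerivWithinAt u (p x) (Ici x) x :=
  (h.hasDeriv x (Ico_subset_Icc_self hx)).mono_of_mem_nhdsWithin (by
    filter_upwards [Icc_mem_nhdsGE hx.2] with y hy using ⟨hx.1.trans hy.1, hy.2⟩)

theorem hasDerivWithinAt_deriv (h : IsSolution L μ u p) {x : ℝ}
    (hx : x ∈ Ico (-(L / 2)) (L / 2)) :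
    HasDerivWithinAt p (((inverseSquare x - μ : ℝ) : ℂ) * u x) (Ici x) x := by
  have hxI := Ico_subset_Icc_self hx
  have hsub : Ioo x (L / 2) ⊆ box L := Ioo_subset_Ioo_left hx.1
  have hF : HasDerivWithinAt
      (fun y => ∫ t in (-(L / 2))..y, ((inverseSquare t - μ : ℝ) : ℂ) * u t)
      (((inverseSquare x - μ : ℝ) : ℂ) * u x) (Ici x) x := by
    refine intervalIntegral.integral_hasDerivWithinAt_right (t := Ioi x)
      (intervalIntegrable_potential_mul h.continuousOn hxI) ?_ ?_
    · exact ⟨Ioo x (L / 2), Ioo_mem_nhdsGT hx.2,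
        ((memLp_potential_mul μ h.continuousOn).aestronglyMeasurable).mono_measure
          (Measure.restrict_mono_set _ hsub)⟩
    · have h1 : ContinuousWithinAt (fun y => ((inverseSquare y - μ : ℝ) : ℂ)) (Ici x) x :=
        Complex.continuous_ofReal.continuousAt.comp_continuousWithinAt
          ((continuousWithinAt_inverseSquare x).sub_const μ)
      exact (h1.mul (h.hasDerivWithinAt hx).continuousWithinAt).mono Ioi_subset_Ici_self
  refine (hF.const_add (p (-(L / 2)))).congr_of_eventuallyEq ?_ (h.primitive x hxI)
  filter_upwards [Icc_mem_nhdsGE hx.2] with y hy using h.primitive y ⟨hx.1.trans hy.1, hy.2⟩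

theorem sub_smul {s p' : ℝ → ℂ} (h : IsSolution L μ u p) (c : ℂ) (hs : IsSolution L μ s p') :
    IsSolution L μ (fun x => u x - c * s x) (fun x => p x - c * p' x) where
  hasDeriv x hx := (h.hasDeriv x hx).sub ((hs.hasDeriv x hx).const_mul c)
  primitive x hx := by
    have h1 := intervalIntegrable_potential_mul (μ := μ) h.continuousOn hx
    have h2 := (intervalIntegrable_potential_mul (μ := μ) hs.continuousOn hx).const_mul c
    have heq : ∀ t, ((inverseSquare t - μ : ℝ) : ℂ) * (u t - c * s t) =
        ((inverseSquare t - μ : ℝ) : ℂ) * u t - c * (((inverseSquare t - μ : ℝ) : ℂ) * s t) :=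
      fun t => by ring
    simp only [heq]
    rw [intervalIntegral.integral_sub h1 h2, intervalIntegral.integral_const_mul,
      h.primitive x hx, hs.primitive x hx]
    ring

/-- Uniqueness for the initial value problem at the left endpoint. -/
theorem eqOn_zero (hL : 0 < L) (h : IsSolution L μ u p) (hu : u (-(L / 2)) = 0)
    (hp : p (-(L / 2)) = 0) : ∀ x ∈ Icc (-(L / 2)) (L / 2), u x = 0 := by
  intro x hx
  have key := eq_zero_of_abs_deriv_le_mul_abs_self_of_eq_zero_right
    (f := fun x => (u x, p x)) (f' := fun x => (p x, ((inverseSquare x - μ : ℝ) : ℂ) * u x))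
    (K := 1 + |μ|) (h.continuousOn.prodMk (h.continuousOn_deriv hL))
    (fun y hy => (h.hasDerivWithinAt hy).prodMk (h.hasDerivWithinAt_deriv hy))
    (by simp [hu, hp]) (fun y _ => by
      have h1 : ‖u y‖ ≤ ‖(u y, p y)‖ := norm_fst_le (u y, p y)
      have h2 : ‖p y‖ ≤ ‖(u y, p y)‖ := norm_snd_le (u y, p y)
      refine norm_prod_le_iff.mpr ⟨?_, ?_⟩
      · exact h2.trans (le_mul_of_one_le_left (norm_nonneg _) (by linarith [abs_nonneg μ]))
      · rw [norm_mul]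
        gcongr
        exact norm_inverseSquare_sub_le y μ) x hx
  exact congrArg Prod.fst key

/-- There are no eigenvalues `μ ≤ 0`: then `|u|²` is convex, since its second derivative is
`2 |u'|² + 2 (v - μ) |u|²`, and vanishes at both endpoints. -/
theorem eqOn_zero_of_nonpos (hL : 0 < L) (hμ : μ ≤ 0) (h : IsSolution L μ u p)
    (hl : u (-(L / 2)) = 0) (hr : u (L / 2) = 0) :
    ∀ x ∈ Icc (-(L / 2)) (L / 2), u x = 0 := by
  have hle : -(L / 2) ≤ L / 2 := by linarith
  have hre {w : ℝ → ℂ} {w' : ℂ} {s : Set ℝ} {x : ℝ} (hw : HasDerivWithinAt w w' s x) :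
      HasDerivWithinAt (fun y => (w y).re) w'.re s x :=
    Complex.reCLM.hasFDerivAt.comp_hasDerivWithinAt x hw
  have him {w : ℝ → ℂ} {w' : ℂ} {s : Set ℝ} {x : ℝ} (hw : HasDerivWithinAt w w' s x) :
      HasDerivWithinAt (fun y => (w y).im) w'.im s x :=
    Complex.imCLM.hasFDerivAt.comp_hasDerivWithinAt x hw
  have hcu := h.continuousOn
  have hcp := h.continuousOn_deriv hL
  have hcur := Complex.continuous_re.comp_continuousOn hcu
  have hcui := Complex.continuous_im.comp_continuousOn hcu
  have hcpr := Complex.continuous_re.comp_continuousOn hcp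
  have hcpi := Complex.continuous_im.comp_continuousOn hcp
  -- Half of the derivative of `|u|²` is zero at the left endpoint and nondecreasing.
  have hg : ∀ x ∈ Icc (-(L / 2)) (L / 2), 0 ≤ (u x).re * (p x).re + (u x).im * (p x).im := by
    intro x hx
    refine image_le_of_deriv_right_le_deriv_boundary (f := fun _ => (0 : ℝ)) (f' := fun _ => 0)
      continuousOn_const (fun x _ => hasDerivWithinAt_const _ _ _) (by simp [hl])
      ((hcur.mul hcpr).add (hcui.mul hcpi))
      (fun y hy => ((hre (h.hasDerivWithinAt hy)).mul (hre (h.hasDerivWithinAt_deriv hy))).add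
        ((him (h.hasDerivWithinAt hy)).mul (him (h.hasDerivWithinAt_deriv hy))))
      (fun y _ => ?_) hx
    rw [Complex.re_ofReal_mul, Complex.im_ofReal_mul]
    simp only [Function.comp_apply]
    have hv : 0 ≤ inverseSquare y - μ := by linarith [inverseSquare_nonneg y]
    have := mul_nonneg hv (add_nonneg (mul_self_nonneg (u y).re) (mul_self_nonneg (u y).im))
    nlinarith [mul_self_nonneg (p y).re, mul_self_nonneg (p y).im]
  intro x hx
  have hmono := image_le_of_deriv_right_le_deriv_boundary (a := x) (b := L / 2)
    (f := fun _ => (u x).re * (u x).re + (u x).im * (u x).im) (f' := fun _ => 0)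
    (B := fun y => (u y).re * (u y).re + (u y).im * (u y).im)
    continuousOn_const (fun x _ => hasDerivWithinAt_const _ _ _) le_rfl
    (((hcur.mul hcur).add (hcui.mul hcui)).mono (Icc_subset_Icc_left hx.1))
    (fun y hy =>
      have hy' : y ∈ Ico (-(L / 2)) (L / 2) := ⟨hx.1.trans hy.1, hy.2⟩
      ((hre (h.hasDerivWithinAt hy')).mul (hre (h.hasDerivWithinAt hy'))).add
        ((him (h.hasDerivWithinAt hy')).mul (him (h.hasDerivWithinAt hy'))))
    (fun y hy => by linarith [hg y ⟨hx.1.trans hy.1, hy.2.le⟩])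
    (right_mem_Icc.mpr hx.2)
  simp only [hr, Complex.zero_re, Complex.zero_im, mul_zero, add_zero] at hmono
  apply Complex.ext <;> simp only [Complex.zero_re, Complex.zero_im] <;>
    nlinarith [mul_self_nonneg (u x).re, mul_self_nonneg (u x).im]

end IsSolution

/-! ### The solution with a given Prüfer angle -/

theorem hasDerivAt_ite_le {f g : ℝ → ℝ} {d c : ℝ} (hfg : f c = g c) (hf : HasDerivAt f d c)
    (hg : HasDerivAt g d c) : HasDerivAt (fun x => if x ≤ c then f x else g x) d c := by
  rw [← hasDerivWithinAt_univ, ← Iic_union_Ici (a := c)]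
  have hl : HasDerivWithinAt (fun x => if x ≤ c then f x else g x) d (Iic c) c :=
    hf.hasDerivWithinAt.congr (fun x hx => if_pos hx) (if_pos le_rfl)
  refine hl.union (hg.hasDerivWithinAt.congr (fun x hx => ?_) ((if_pos le_rfl).trans hfg))
  rcases eq_or_lt_of_le (show c ≤ x from hx) with rfl | hlt
  · exact (if_pos le_rfl).trans hfg
  · exact if_neg hlt.not_ge

theorem hasDerivAt_ite_le_of_lt {f g : ℝ → ℝ} {d c x : ℝ} (hx : x < c) (hf : HasDerivAt f d x) :
    HasDerivAt (fun x => if x ≤ c then f x else g x) d x :=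
  hf.congr_of_eventuallyEq ((gt_mem_nhds hx).mono fun _ hy => if_pos (le_of_lt hy))

theorem hasDerivAt_ite_le_of_gt {f g : ℝ → ℝ} {d c x : ℝ} (hx : c < x) (hg : HasDerivAt g d x) :
    HasDerivAt (fun x => if x ≤ c then f x else g x) d x :=
  hg.congr_of_eventuallyEq ((lt_mem_nhds hx).mono fun _ hy => if_neg (not_le_of_gt hy))

/-- The solution `u = r sin θ`, `u' = k r cos θ`. The radius is `1` to the left of `1`, and it
satisfies `r' = r sin θ cos θ / (k x²)` to the right of `1`. -/
theorem IsPrueferAngle.exists_isSolution {L k : ℝ} {θ : ℝ → ℝ} (hL : 2 < L) (hk : 0 < k)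
    (h : IsPrueferAngle (L / 2) k θ) :
    ∃ s p : ℝ → ℂ, IsSolution L (k ^ 2) s p ∧ s (-(L / 2)) = 0 ∧ p (-(L / 2)) ≠ 0 ∧
      (s (L / 2) = 0 ↔ Real.sin (θ (L / 2)) = 0) := by
  have hR : 1 < L / 2 := by linarith
  have hθc := h.continuous
  let F : ℝ → ℝ := fun t => Real.sin (θ t) * Real.cos (θ t) / (k * (max 1 t) ^ 2)
  have hF : Continuous F :=
    Continuous.div (by fun_prop) (by fun_prop)
      fun t => (hk.trans_le (le_mul_max_sq hk t)).ne'
  let r : ℝ → ℝ := fun x => Real.exp (∫ t in (1 : ℝ)..x, F t)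
  have hr (x : ℝ) : HasDerivAt r (r x * F x) x := (hF.integral_hasStrictDerivAt 1 x).hasDerivAt.exp
  have hr1 : r 1 = 1 := by simp [r]
  have hr0 (x : ℝ) : r x ≠ 0 := (Real.exp_pos _).ne'
  let s₀ : ℝ → ℝ := fun x => Real.sin (k * (x + L / 2))
  let p₀ : ℝ → ℝ := fun x => k * Real.cos (k * (x + L / 2))
  let s₁ : ℝ → ℝ := fun x => r x * Real.sin (θ x)
  let p₁ : ℝ → ℝ := fun x => k * (r x * Real.cos (θ x))
  have hlin (x : ℝ) : HasDerivAt (fun x => k * (x + L / 2)) k x := by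
    simpa using ((hasDerivAt_id x).add_const (L / 2)).const_mul k
  have hs₀ (x : ℝ) : HasDerivAt s₀ (p₀ x) x := by
    refine (hlin x).sin.congr_deriv ?_
    simp only [p₀]; ring
  have hp₀ (x : ℝ) : HasDerivAt p₀ (-k ^ 2 * s₀ x) x := by
    refine ((hlin x).cos.const_mul k).congr_deriv ?_
    simp only [s₀]; ring
  have hs₁ {x : ℝ} (hx : x ∈ Icc 1 (L / 2)) : HasDerivAt s₁ (p₁ x) x := by
    have hx0 : x ≠ 0 := by linarith [hx.1]
    refine ((hr x).mul (h.hasDerivAt x hx).sin).congr_deriv ?_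
    simp only [p₁, F, max_eq_right hx.1]
    field_simp
    ring
  have hp₁ {x : ℝ} (hx : x ∈ Icc 1 (L / 2)) :
      HasDerivAt p₁ ((1 / x ^ 2 - k ^ 2) * s₁ x) x := by
    have hx0 : x ≠ 0 := by linarith [hx.1]
    refine (((hr x).mul (h.hasDerivAt x hx).cos).const_mul k).congr_deriv ?_
    simp only [s₁, F, max_eq_right hx.1]
    field_simp
    linear_combination (r x * Real.sin (θ x)) * Real.sin_sq_add_cos_sq (θ x)
  have hs1 : s₀ 1 = s₁ 1 := by simp only [s₀, s₁, hr1, h.init, one_mul]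
  have hp1 : p₀ 1 = p₁ 1 := by simp only [p₀, p₁, hr1, h.init, one_mul]
  let s : ℝ → ℝ := fun x => if x ≤ 1 then s₀ x else s₁ x
  let p : ℝ → ℝ := fun x => if x ≤ 1 then p₀ x else p₁ x
  have hs : ∀ x ∈ Icc (-(L / 2)) (L / 2), HasDerivAt s (p x) x := by
    intro x hx
    rcases lt_trichotomy x 1 with hlt | rfl | hgt
    · rw [show p x = p₀ x from if_pos hlt.le]
      exact hasDerivAt_ite_le_of_lt hlt (hs₀ x)
    · rw [show p 1 = p₀ 1 from if_pos le_rfl]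
      exact hasDerivAt_ite_le hs1 (hs₀ 1) (hp1 ▸ hs₁ ⟨le_rfl, hR.le⟩)
    · rw [show p x = p₁ x from if_neg hgt.not_ge]
      exact hasDerivAt_ite_le_of_gt hgt (hs₁ ⟨hgt.le, hx.2⟩)
  have hp : ∀ x ∈ Icc (-(L / 2)) (L / 2), x ≠ 1 →
      HasDerivAt p ((inverseSquare x - k ^ 2) * s x) x := by
    intro x hx hx1
    rcases lt_or_gt_of_ne hx1 with hlt | hgt
    · rw [show s x = s₀ x from if_pos hlt.le, inverseSquare_of_lt hlt, zero_sub]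
      exact hasDerivAt_ite_le_of_lt hlt (hp₀ x)
    · rw [show s x = s₁ x from if_neg hgt.not_ge, inverseSquare_of_le hgt.le]
      exact hasDerivAt_ite_le_of_gt hgt (hp₁ ⟨hgt.le, hx.2⟩)
  have hpc : ContinuousOn p (Icc (-(L / 2)) (L / 2)) := by
    intro x hx
    by_cases hx1 : x = 1
    · subst hx1
      have hc : ContinuousAt p 1 := by
        rw [continuousAt_iff_continuous_left_right]
        constructor
        · exact (hp₀ 1).continuousAt.continuousWithinAt.congr (fun y hy => if_pos hy)
            (if_pos le_rfl)
        · refine (hp₁ ⟨le_rfl, hR.le⟩).continuousAt.continuousWithinAt.congr (fun y hy => ?_)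
            ((if_pos le_rfl).trans hp1)
          rcases eq_or_lt_of_le (show 1 ≤ y from hy) with rfl | hlt
          · exact (if_pos le_rfl).trans hp1
          · exact if_neg hlt.not_ge
      exact hc.continuousWithinAt
    · exact (hp x hx hx1).continuousAt.continuousWithinAt
  have hsC : ∀ x ∈ Icc (-(L / 2)) (L / 2),
      HasDerivAt (fun y => (s y : ℂ)) (p x : ℂ) x := fun x hx => (hs x hx).ofReal_comp
  have hsc : ContinuousOn (fun y => (s y : ℂ)) (Icc (-(L / 2)) (L / 2)) :=
    fun x hx => (hsC x hx).continuousAt.continuousWithinAt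
  have hleft : -(L / 2) ≤ 1 := by linarith
  refine ⟨fun x => s x, fun x => p x, ⟨fun x hx => (hsC x hx).hasDerivWithinAt, fun x hx => ?_⟩,
    ?_, ?_, ?_⟩
  · rw [integral_eq_of_hasDerivAt_off_countable_of_le (fun y => (p y : ℂ)) _ hx.1
      (countable_singleton (1 : ℝ))
      (Complex.continuous_ofReal.comp_continuousOn (hpc.mono (Icc_subset_Icc_right hx.2)))
      (fun y hy => ?_) (intervalIntegrable_potential_mul hsc hx)]
    · ring
    · have := (hp y ⟨hy.1.1.le, hy.1.2.le.trans hx.2⟩ hy.2).ofReal_comp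
      push_cast at this ⊢
      exact this
  · simp [s, s₀, hleft]
  · simp [p, p₀, hleft, hk.ne']
  · simp only [Complex.ofReal_eq_zero]
    simp [s, s₁, hR.not_ge, hr0]

/-! ### Eigenspaces -/

theorem mem_eigenspace_iff_isSolution {L μ : ℝ} {f : L2Box L} :
    f ∈ eigenspace (dirichletSchrodinger inverseSquare L) (μ : ℂ) ↔
      ∃ u p, IsSolution L μ u p ∧ u (-(L / 2)) = 0 ∧ u (L / 2) = 0 ∧
        f =ᵐ[volume.restrict (box L)] u := by
  have hgraph : f ∈ eigenspace (dirichletSchrodinger inverseSquare L) (μ : ℂ) ↔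
      (f, (μ : ℂ) • f) ∈ (dirichletSchrodinger inverseSquare L).graph := Iff.rfl
  rw [hgraph, mem_graph_dirichletSchrodinger]
  constructor
  · rintro ⟨u, p, q, h, hf, hg⟩
    refine ⟨u, p, ⟨h.hasDeriv, fun x hx => ?_⟩, h.left, h.right, hf⟩
    rw [h.primitive x hx]
    congr 1
    rw [intervalIntegral.integral_of_le hx.1, intervalIntegral.integral_of_le hx.1,
      integral_Ioc_eq_integral_Ioo, integral_Ioc_eq_integral_Ioo]
    refine integral_congr_ae (ae_restrict_of_ae_restrict_of_subset
      (Ioo_subset_Ioo_right hx.2) ?_)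
    filter_upwards [hf, hg, Lp.coeFn_smul (μ : ℂ) f] with t h1 h2 h3
    rw [h3, Pi.smul_apply, h1, smul_eq_mul] at h2
    push_cast
    linear_combination h2
  · rintro ⟨u, p, h, hl, hr, hf⟩
    refine ⟨u, p, _, ⟨h.hasDeriv, memLp_potential_mul μ h.continuousOn, h.primitive, hl, hr⟩,
      hf, ?_⟩
    filter_upwards [hf, Lp.coeFn_smul (μ : ℂ) f] with t h1 h3
    rw [h3, Pi.smul_apply, h1, smul_eq_mul]
    push_cast
    ring

theorem eq_zero_of_eqOn_zero {L : ℝ} {f : L2Box L} {u : ℝ → ℂ}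
    (hf : f =ᵐ[volume.restrict (box L)] u) (hu : ∀ x ∈ Icc (-(L / 2)) (L / 2), u x = 0) :
    f = 0 := by
  apply Lp.ext
  filter_upwards [hf, ae_restrict_mem measurableSet_Ioo,
    Lp.coeFn_zero ℂ 2 (volume.restrict (box L))] with x h1 h2 h3
  rw [h1, h3, hu x (Ioo_subset_Icc_self h2), Pi.zero_apply]

theorem eigenspace_eq_bot_of_nonpos {L μ : ℝ} (hL : 0 < L) (hμ : μ ≤ 0) :
    eigenspace (dirichletSchrodinger inverseSquare L) (μ : ℂ) = ⊥ := by
  rw [Submodule.eq_bot_iff]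
  intro f hf
  obtain ⟨u, p, h, hl, hr, hfu⟩ := mem_eigenspace_iff_isSolution.mp hf
  exact eq_zero_of_eqOn_zero hfu (h.eqOn_zero_of_nonpos hL hμ hl hr)

namespace IsPrueferAngle

variable {L k : ℝ} {θ : ℝ → ℝ}

theorem rank_eigenspace_le_one (hL : 2 < L) (hk : 0 < k) (h : IsPrueferAngle (L / 2) k θ) :
    Module.rank ℂ (eigenspace (dirichletSchrodinger inverseSquare L) ((k ^ 2 : ℝ) : ℂ)) ≤ 1 := by
  obtain ⟨s, p', hs, hs0, hp0, -⟩ := h.exists_isSolution hL hk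
  have hmem := memLp_of_continuousOn hs.continuousOn
  refine (rank_submodule_le_one_iff' _).mpr ⟨hmem.toLp s, fun f hf => ?_⟩
  obtain ⟨u, p, hu, hl, -, hfu⟩ := mem_eigenspace_iff_isSolution.mp hf
  set c := p (-(L / 2)) / p' (-(L / 2)) with hc
  refine Submodule.mem_span_singleton.mpr ⟨c, (sub_eq_zero.mp ?_).symm⟩
  refine eq_zero_of_eqOn_zero (u := fun x => u x - c * s x) ?_
    ((hu.sub_smul c hs).eqOn_zero (by linarith) (by simp [hl, hs0]) (by simp [hc, hp0]))
  filter_upwards [hfu, hmem.coeFn_toLp, Lp.coeFn_smul c (hmem.toLp s),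
    Lp.coeFn_sub f (c • hmem.toLp s)] with x h1 h2 h3 h4
  rw [h4, Pi.sub_apply, h1, h3, Pi.smul_apply, h2, smul_eq_mul]

theorem eigenspace_ne_bot_iff (hL : 2 < L) (hk : 0 < k) (h : IsPrueferAngle (L / 2) k θ) :
    eigenspace (dirichletSchrodinger inverseSquare L) ((k ^ 2 : ℝ) : ℂ) ≠ ⊥ ↔
      Real.sin (θ (L / 2)) = 0 := by
  have hL0 : 0 < L := by linarith
  have hle : -(L / 2) ≤ L / 2 := by linarith
  obtain ⟨s, p', hs, hs0, hp0, hsin⟩ := h.exists_isSolution hL hk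
  rw [← hsin, Submodule.ne_bot_iff]
  constructor
  · rintro ⟨f, hf, hf0⟩
    obtain ⟨u, p, hu, hl, hr, hfu⟩ := mem_eigenspace_iff_isSolution.mp hf
    set c := p (-(L / 2)) / p' (-(L / 2)) with hc
    have hzero := (hu.sub_smul c hs).eqOn_zero hL0 (by simp [hl, hs0]) (by simp [hc, hp0])
    have hR := hzero (L / 2) (right_mem_Icc.mpr hle)
    simp only [hr, zero_sub, neg_eq_zero, mul_eq_zero] at hR
    refine hR.resolve_left fun hc0 => hf0 (eq_zero_of_eqOn_zero hfu fun x hx => ?_)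
    simpa [hc0] using hzero x hx
  · intro hsR
    have hmem := memLp_of_continuousOn hs.continuousOn
    refine ⟨hmem.toLp s, mem_eigenspace_iff_isSolution.mpr
      ⟨s, p', hs, hs0, hsR, hmem.coeFn_toLp⟩, fun h0 => hp0 ?_⟩
    -- If `s` vanished almost everywhere, it would vanish identically, and so would `s'`.
    have hae : s =ᵐ[volume.restrict (box L)] 0 := (MemLp.toLp_eq_toLp_iff hmem MemLp.zero).mp
      (h0.trans (MemLp.toLp_zero _).symm)
    have hopen : EqOn s 0 (box L) := Measure.eqOn_open_of_ae_eq hae isOpen_Ioo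
      (hs.continuousOn.mono Ioo_subset_Icc_self) continuousOn_const
    have hleft : -(L / 2) ∈ Ico (-(L / 2)) (L / 2) := ⟨le_rfl, by linarith⟩
    have h1 := hs.hasDerivWithinAt hleft
    have h2 : HasDerivWithinAt s 0 (Ici (-(L / 2))) (-(L / 2)) := by
      refine (hasDerivWithinAt_const (-(L / 2)) _ (0 : ℂ)).congr_of_eventuallyEq ?_ hs0
      filter_upwards [Ico_mem_nhdsGE hleft.2] with y hy
      rcases eq_or_lt_of_le hy.1 with rfl | hlt
      · exact hs0
      · exact hopen ⟨hlt, hy.2⟩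
    exact (uniqueDiffWithinAt_Ici _).eq_deriv _ h1 h2

end IsPrueferAngle

/-! ### Counting eigenvalues -/

section Abstract

variable {E : Type*} [AddCommGroup E] [Module ℂ E] {T : E →ₗ.[ℂ] E}

theorem eigenspace_le_eigenspan {μ t : ℝ} (h : μ ≤ t) : eigenspace T (μ : ℂ) ≤ eigenspan T t :=
  le_iSup₂_of_le μ h le_rfl

theorem eigenspan_le {t : ℝ} {S : Submodule ℂ E}
    (h : ∀ μ ≤ t, eigenspace T (μ : ℂ) ≠ ⊥ → eigenspace T (μ : ℂ) ≤ S) : eigenspan T t ≤ S :=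
  iSup₂_le fun μ hμ => (eq_or_ne (eigenspace T (μ : ℂ)) ⊥).elim
    (fun h0 => h0.trans_le bot_le) (h μ hμ)

theorem one_le_rank_eigenspan {μ t : ℝ} (h : eigenspace T (μ : ℂ) ≠ ⊥) (ht : μ ≤ t) :
    1 ≤ Module.rank ℂ (eigenspan T t) := by
  obtain ⟨f, hf, hf0⟩ := Submodule.exists_mem_ne_zero_of_ne_bot h
  exact Cardinal.one_le_iff_pos.mpr (rank_pos_iff_exists_ne_zero.mpr
    ⟨⟨f, eigenspace_le_eigenspan ht hf⟩, fun h => hf0 (congrArg Subtype.val h)⟩)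

theorem two_le_rank_eigenspan {μ μ' t : ℝ} (hne : μ ≠ μ') (h : eigenspace T (μ : ℂ) ≠ ⊥)
    (h' : eigenspace T (μ' : ℂ) ≠ ⊥) (ht : μ ≤ t) (ht' : μ' ≤ t) :
    2 ≤ Module.rank ℂ (eigenspan T t) := by
  obtain ⟨f, hf, hf0⟩ := Submodule.exists_mem_ne_zero_of_ne_bot h
  obtain ⟨g, hg, hg0⟩ := Submodule.exists_mem_ne_zero_of_ne_bot h'
  let f' : eigenspan T t := ⟨f, eigenspace_le_eigenspan ht hf⟩
  let g' : eigenspan T t := ⟨g, eigenspace_le_eigenspan ht' hg⟩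
  have hli : LinearIndependent ℂ ![f', g'] := by
    rw [LinearIndependent.pair_iff' fun h => hf0 (congrArg Subtype.val h)]
    intro a ha
    have hag : a • f = g := congrArg Subtype.val ha
    have hg1 : g ∈ eigenspace T (μ : ℂ) := hag ▸ Submodule.smul_mem _ a hf
    obtain ⟨_, h1⟩ := mem_eigenspace.mp hg1
    obtain ⟨_, h2⟩ := mem_eigenspace.mp hg
    have h3 : ((μ : ℂ) - μ') • g = 0 := by rw [sub_smul, ← h1, ← h2, sub_self]
    rcases smul_eq_zero.mp h3 with h4 | h4
    · exact hne (by exact_mod_cast sub_eq_zero.mp h4)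
    · exact hg0 h4
  simpa using hli.cardinal_lift_le_rank

theorem le_of_le_rank_eigenspan {n : ℕ} {c t : ℝ}
    (hc : ∀ μ : ℝ, μ < c → eigenspace T (μ : ℂ) = ⊥)
    (ht : ((n + 1 : ℕ) : Cardinal) ≤ Module.rank ℂ (eigenspan T t)) : c ≤ t := by
  by_contra! hlt
  have hbot : eigenspan T t = ⊥ :=
    le_bot_iff.mp (eigenspan_le fun μ hμ h => absurd (hc μ (hμ.trans_lt hlt)) h)
  rw [hbot, rank_bot] at ht
  simp at ht

/-- The lower bound `c` on all eigenvalues keeps the infimum in the definition of `eigenvalue` from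
being the junk value of an unbounded set. -/
theorem eigenvalue_le {n : ℕ} {c t : ℝ} (hc : ∀ μ : ℝ, μ < c → eigenspace T (μ : ℂ) = ⊥)
    (ht : ((n + 1 : ℕ) : Cardinal) ≤ Module.rank ℂ (eigenspan T t)) : eigenvalue T n ≤ t :=
  csInf_le ⟨c, fun _ hs => le_of_le_rank_eigenspan hc hs⟩ ht

theorem le_eigenvalue {n : ℕ} {c t : ℝ}
    (ht : ((n + 1 : ℕ) : Cardinal) ≤ Module.rank ℂ (eigenspan T t))
    (h : ∀ s : ℝ, ((n + 1 : ℕ) : Cardinal) ≤ Module.rank ℂ (eigenspan T s) → c ≤ s) :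
    c ≤ eigenvalue T n :=
  le_csInf ⟨t, ht⟩ h

end Abstract

/-! ### The two lowest eigenvalues -/

/-- An eigenvalue `μ` has the form `k²`, and the Prüfer angle for `k` is a positive multiple of `π`
at the right endpoint. -/
theorem exists_isPrueferAngle_of_eigenspace_ne_bot {L μ : ℝ} (hL : 2 < L)
    (h : eigenspace (dirichletSchrodinger inverseSquare L) (μ : ℂ) ≠ ⊥) :
    ∃ k θ, 0 < k ∧ μ = k ^ 2 ∧ IsPrueferAngle (L / 2) k θ ∧
      ∃ n : ℕ, 0 < n ∧ θ (L / 2) = n * Real.pi := by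
  have hR : 1 < L / 2 := by linarith
  have hμ : 0 < μ := by
    by_contra! hle
    exact h (eigenspace_eq_bot_of_nonpos (by linarith) hle)
  have hk := Real.sqrt_pos.mpr hμ
  have hsq : μ = √μ ^ 2 := (Real.sq_sqrt hμ.le).symm
  obtain ⟨θ, hθ⟩ := exists_isPrueferAngle hR hk
  rw [hsq, hθ.eigenspace_ne_bot_iff hL hk, Real.sin_eq_zero_iff] at h
  obtain ⟨n, hn⟩ := h
  have hn0 : 0 < n := by
    have := hθ.pos hR hk
    rw [← hn] at this
    exact_mod_cast (pos_iff_pos_of_mul_pos this).mpr Real.pi_pos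
  lift n to ℕ using hn0.le
  exact ⟨√μ, θ, hk, hsq, hθ, n, by exact_mod_cast hn0, by exact_mod_cast hn.symm⟩

/-- All eigenvalues except one are at least `(2 (π + 1/25) / L)²`. -/
theorem eigenvalue_ge_or_eq {L k₀ μ : ℝ} {θ₀ : ℝ → ℝ} (hL : 10 ≤ L) (hk₀ : 0 < k₀)
    (h₀ : IsPrueferAngle (L / 2) k₀ θ₀) (hπ : θ₀ (L / 2) = Real.pi)
    (h : eigenspace (dirichletSchrodinger inverseSquare L) (μ : ℂ) ≠ ⊥) :
    μ = k₀ ^ 2 ∨ (2 * (Real.pi + 1 / 25) / L) ^ 2 ≤ μ := by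
  have hR : 1 < L / 2 := by linarith
  obtain ⟨k, θ, hk, rfl, hθ, n, hn, hnπ⟩ :=
    exists_isPrueferAngle_of_eigenspace_ne_bot (by linarith) h
  -- By strict monotonicity in the wave number, `π` is attained at `k₀` only.
  rcases Nat.lt_or_ge n 2 with hn2 | hn2
  · left
    obtain rfl : n = 1 := by omega
    rw [Nat.cast_one, one_mul, ← hπ] at hnπ
    rcases lt_trichotomy k k₀ with hlt | rfl | hgt
    · exact absurd hnπ (hθ.lt_of_lt hR hk hlt h₀).ne
    · rfl
    · exact absurd hnπ (h₀.lt_of_lt hR hk₀ hgt hθ).ne'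
  · right
    have h2 : 2 * Real.pi ≤ θ (L / 2) := by
      rw [hnπ]
      have : (2 : ℝ) ≤ n := by exact_mod_cast hn2
      gcongr
    have hge := hθ.wave_number_ge (by linarith) hk h2
    have hpi := Real.pi_pos
    gcongr
    rw [div_le_iff₀ (by linarith)]
    linarith

end SpectralGap

end

open SpectralGap

theorem theorem4 :
    ∃ α β : ℝ, 0 < α ∧ α < β ∧ ∃ L₀ : ℝ, 0 < L₀ ∧ ∀ L : ℝ, L₀ ≤ L →
      α / L ^ 2 ≤ SpectralGap.gap SpectralGap.inverseSquare L ∧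
        SpectralGap.gap SpectralGap.inverseSquare L ≤ β / L ^ 2 := by
  have hpi := Real.pi_pos
  have hpi3 := Real.pi_gt_three
  have hα : 0 < (2 * (Real.pi + 1 / 25)) ^ 2 - (2 * Real.pi) ^ 2 := by nlinarith
  refine ⟨(2 * (Real.pi + 1 / 25)) ^ 2 - (2 * Real.pi) ^ 2, (4 * Real.pi) ^ 2, hα,
    by nlinarith, 10, by norm_num, fun L hL => ?_⟩
  have hL0 : 0 < L := by linarith
  have hR : 1 < L / 2 := by linarith
  obtain ⟨k₀, θ₀, hk₀, hk₀le, hθ₀, hπ₀⟩ := exists_isPrueferAngle_eq hR one_pos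
  obtain ⟨k₁, θ₁, hk₁, hk₁le, hθ₁, hπ₁⟩ := exists_isPrueferAngle_eq hR two_pos
  push_cast at hk₀le hk₁le hπ₀ hπ₁
  rw [one_mul] at hπ₀ hk₀le
  set T := dirichletSchrodinger inverseSquare L with hT
  have hE₀ : eigenspace T ((k₀ ^ 2 : ℝ) : ℂ) ≠ ⊥ :=
    (hθ₀.eigenspace_ne_bot_iff (by linarith) hk₀).mpr (by rw [hπ₀, Real.sin_pi])
  have hE₁ : eigenspace T ((k₁ ^ 2 : ℝ) : ℂ) ≠ ⊥ :=
    (hθ₁.eigenspace_ne_bot_iff (by linarith) hk₁).mpr (by rw [hπ₁, Real.sin_two_pi])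
  have hlt : k₀ < k₁ := by
    by_contra! hle
    rcases hle.eq_or_lt with rfl | h
    · have h1 : (2 : ℝ) * Real.pi ≤ θ₁ (L / 2) := hπ₁.ge
      have := hθ₁.wave_number_ge (by linarith) hk₁ h1
      nlinarith
    · have := hθ₁.lt_of_lt hR hk₁ h hθ₀
      linarith
  have hbot (μ : ℝ) (hμ : μ < 0) : eigenspace T (μ : ℂ) = ⊥ :=
    eigenspace_eq_bot_of_nonpos hL0 hμ.le
  have hrank₀ : ((0 + 1 : ℕ) : Cardinal) ≤ Module.rank ℂ (eigenspan T (k₀ ^ 2)) := by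
    simpa using one_le_rank_eigenspan hE₀ le_rfl
  have hsq : k₀ ^ 2 < k₁ ^ 2 := by gcongr
  have hrank₁ : ((1 + 1 : ℕ) : Cardinal) ≤ Module.rank ℂ (eigenspan T (k₁ ^ 2)) := by
    exact_mod_cast two_le_rank_eigenspan hsq.ne hE₀ hE₁ hsq.le le_rfl
  have h0le : eigenvalue T 0 ≤ k₀ ^ 2 := eigenvalue_le hbot hrank₀
  have h1le : eigenvalue T 1 ≤ k₁ ^ 2 := eigenvalue_le hbot hrank₁
  have h0ge : 0 ≤ eigenvalue T 0 :=
    le_eigenvalue hrank₀ fun s hs => le_of_le_rank_eigenspan hbot hs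
  have h1ge : (2 * (Real.pi + 1 / 25) / L) ^ 2 ≤ eigenvalue T 1 := by
    refine le_eigenvalue hrank₁ fun s hs => ?_
    by_contra! hs'
    -- Below the bound, the only eigenvalue is `k₀ ^ 2`, and it is simple.
    have hle : eigenspan T s ≤ eigenspace T ((k₀ ^ 2 : ℝ) : ℂ) := by
      refine eigenspan_le fun μ hμ h => ?_
      rcases eigenvalue_ge_or_eq hL hk₀ hθ₀ hπ₀ h with rfl | hge
      · exact le_rfl
      · exact absurd (hge.trans hμ) hs'.not_ge
    have h1 := hs.trans ((Submodule.rank_mono hle).trans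
      (hθ₀.rank_eigenspace_le_one (by linarith) hk₀))
    have : (1 + 1 : ℕ) ≤ 1 := by exact_mod_cast h1
    omega
  have hk₀L : k₀ ≤ 2 * Real.pi / L := by
    rw [le_div_iff₀ hL0]; nlinarith
  have hk₁L : k₁ ≤ 4 * Real.pi / L := by
    rw [le_div_iff₀ hL0]; nlinarith
  have hk₀sq : k₀ ^ 2 ≤ (2 * Real.pi / L) ^ 2 := by gcongr
  have hk₁sq : k₁ ^ 2 ≤ (4 * Real.pi / L) ^ 2 := by gcongr
  rw [gap, sub_div, ← div_pow, ← div_pow, ← div_pow]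
  constructor <;> linarith
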